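/- Let $L=\begin{pmatrix}1&0\\1&1\end{pmatrix}$ and $R=\begin{pmatrix}1&1\\0&1\end{pmatrix}$. Every $\{L,R\}$-word represents an element of $\mathrm{PSL}_2(\mathbb Z)$, every element of infinite order is conjugate to one represented by a non-empty word, and this word is unique up to cyclic permutation. The transpose ${}^tw$ of a word $w$ is obtained by reversing $w$ and exchanging $L$ and $R$. For a word $P$ and a non-empty word $w$, let $\mathrm{occ}_P(w)$ be the number of $0\le j<\mathrm{len}(w)$ such that $P$ is a prefix of the periodic sequence $www\cdots$ with its first $j$ letters removed. Define $\mathrm{mas}_P\colon \mathrm{PSL}_2(\mathbb Z)\to\mathbb Z$ by $\mathrm{mas}_P(A)=\mathrm{occ}_P(w)-\mathrm{occ}_{{}^tP}(w)$ if $A$ has infinite order and is conjugate to the element represented by the non-empty word $w$, and by $\mathrm{mas}_P(A)=0$ if $A$ has finite order. A homogeneous quasi-morphism on a group $\Pi$ is a function $f\colon\Pi\to\mathbb R$ such that $f(B)-f(AB)+f(A)$ is bounded over all $A,B\in\Pi$ and $f(A^n)=nf(A)$ for all $A\in\Pi$, $n\in\mathbb N$; these form a real vector space $PX(\Pi)$.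 Let $\mathcal P$ be the set of Lyndon words, namely the $\{L,R\}$-words which are strictly greater, in the lexicographic order extending $L<R$, than all their non-trivial cyclic permutations. Let $\mathcal P_0\subset\mathcal P$ be the subset of those which are a cyclic permutation of their transpose. For $P\in\mathcal P$ let $\tau(P)\in\mathcal P$ be the Lyndon word which is a cyclic permutation of ${}^tP$. Let $\mathcal P\setminus\mathcal P_0=\mathcal P_-\sqcup\mathcal P_+$ be any partition into two subsets such that $\tau$ maps $\mathcal P_+$ bijectively onto $\mathcal P_-$. Then the functions $\mathrm{mas}_P$, for $P\in\mathcal P_+$, are homogeneous quasi-morphisms on $\mathrm{PSL}_2(\mathbb Z)$ and are linearly independent in $PX(\mathrm{PSL}_2(\mathbb Z))$. Moreover, for each $A\in\mathrm{PSL}_2(\mathbb Z)$ only finitely many $P\in\mathcal P_+$ satisfy $\mathrm{mas}_P(A)\neq 0$, and for every $f\in PX(\mathrm{PSL}_2(\mathbb Z))$ there is a unique family $(m_P(f))_{P\in\mathcal P_+}\in\mathbb R^{\mathcal P_+}$ such that $f=\sum_{P\in\mathcal P_+}m_P(f)\,\mathrm{mas}_P$, that is, $f(A)=\sum_{P\in\mathcal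 P_+}m_P(f)\,\mathrm{mas}_P(A)$ for every $A\in\mathrm{PSL}_2(\mathbb Z)$. -/

import Mathlib

namespace ModularWord

/-- The modular group `PSL₂(ℤ)`. -/
abbrev PSLZ : Type := Matrix.ProjectiveSpecialLinearGroup (Fin 2) ℤ

/-- Words in the letters `L` (coded by `false`) and `R` (coded by `true`). The order `<` on words
is the lexicographic order extending `L < R`. -/
abbrev Word : Type := List Bool

/-- The matrices `L = (1 0; 1 1)` and `R = (1 1; 0 1)`. -/
def letter : Bool → Matrix.SpecialLinearGroup (Fin 2) ℤ
  | false => ⟨!![1, 0; 1, 1], by simp [Matrix.det_fin_two]⟩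
  | true => ⟨!![1, 1; 0, 1], by simp [Matrix.det_fin_two]⟩

/-- The element of `PSL₂(ℤ)` represented by a word. -/
def toPSL (w : Word) : PSLZ :=
  QuotientGroup.mk (w.map letter).prod

/-- Transposition of matrices, on words: reverse the word and exchange `L` and `R`. -/
def transpose (w : Word) : Word := (w.map not).reverse

/-- The letter number `n` (from `0`) of the periodic sequence `A^∞`, for a non-empty word `A`. -/
def periodic (A : Word) (n : ℕ) : Bool := A.getD (n % A.length) false

/-- The number of cyclic occurrences of the pattern `P` in the non-empty word `A`: the number of
shifts `σ^j A^∞`, with `j` in a full period, of which `P` is a prefix. -/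
def occ (P A : Word) : ℕ :=
  ((Finset.range A.length).filter
    fun j => ∀ i : Fin P.length, P.get i = periodic A (j + i)).card

open Classical in
/-- The `P`-asymmetry. If `A` is conjugate to the element represented by a non-empty word `w`
(that is, if `A` has infinite order; `w` is then unique up to cyclic permutation, and `occ P w`
depends on `w` only up to cyclic permutation), it is `occ P w - occ (transpose P) w`;
it is `0` on elements of finite order. -/
noncomputable def mas (P : Word) (A : PSLZ) : ℤ :=
  if h : ∃ w : Word, w ≠ [] ∧ IsConj (toPSL w) A then
    (occ P h.choose : ℤ) - (occ (transpose P) h.choose : ℤ)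
  else 0

/-- `mas P` as a real-valued function. -/
noncomputable def masReal (P : Word) : PSLZ → ℝ := fun A => (mas P A : ℝ)

/-- The real vector space of homogeneous quasi-morphisms on a group. -/
def PX (G : Type*) [Group G] : Submodule ℝ (G → ℝ) where
  carrier := {f | (∃ D : ℝ, ∀ A B : G, |f B - f (A * B) + f A| ≤ D) ∧
    ∀ (A : G) (n : ℕ), f (A ^ n) = n * f A}
  zero_mem' := ⟨⟨0, by simp⟩, by simp⟩
  add_mem' := by
    rintro f g ⟨⟨D, hD⟩, hf⟩ ⟨⟨E, hE⟩, hg⟩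
    refine ⟨⟨D + E, fun A B => ?_⟩, fun A n => ?_⟩
    · have h : (f + g) B - (f + g) (A * B) + (f + g) A
          = (f B - f (A * B) + f A) + (g B - g (A * B) + g A) := by
        simp only [Pi.add_apply]; ring
      rw [h]
      exact (abs_add_le _ _).trans (add_le_add (hD A B) (hE A B))
    · simp only [Pi.add_apply, hf, hg]; ring
  smul_mem' := by
    rintro c f ⟨⟨D, hD⟩, hf⟩
    refine ⟨⟨|c| * D, fun A B => ?_⟩, fun A n => ?_⟩
    · have h : (c • f) B - (c • f) (A * B) + (c • f) A = c * (f B - f (A * B) + f A) := by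
        simp only [Pi.smul_apply, smul_eq_mul]; ring
      rw [h, abs_mul]
      exact mul_le_mul_of_nonneg_left (hD A B) (abs_nonneg c)
    · simp only [Pi.smul_apply, smul_eq_mul, hf]; ring

/-- The Lyndon words: those strictly greater than all their non-trivial cyclic permutations. -/
def lyndonWords : Set Word :=
  {P | ∀ k : ℕ, 0 < k → k < P.length → P.rotate k < P}

/-- The Lyndon words that are cyclic permutations of their transpose; equivalently, those whose
conjugacy class in `PSL₂(ℤ)` is stable under inversion. -/
def symmetricLyndonWords : Set Word :=
  {P | P ∈ lyndonWords ∧ transpose P ~r P}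

/-- The greatest cyclic permutation of the transpose of `P`. For a Lyndon word `P`, it is the
Lyndon word that represents the transposed cyclic word. -/
def lyndonTranspose (P : Word) : Word :=
  (transpose P).cyclicPermutations.foldr max []

end ModularWord

/-! ### Normal forms in `PSL₂(ℤ)` by words of turns. -/

namespace ModularWord

open ModularGroup

/-! Modulo the order-two group generated by `flip` on both sides, each element of `PSL₂(ℤ)` is
represented by exactly one word, its word of turns. The turns of a product are either the
concatenation of the two words, or what is left when a suffix `y` cancels against the prefix
`transpose y` and at most one pair of equal letters then merges into one letter. Counting
occurrences of `P` minus those of `transpose P` is additive under concatenation up to a bounded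
error and odd under transposition, so the cancelled part contributes only a bounded amount: this
count is a quasi-morphism, and `masReal P` is its homogenization (`linearAsymmetry_pow_masReal`).

The expansion is a triangularity argument. A Lyndon word has no proper period, so it has no cyclic
occurrence in a shorter non-empty word; in a word of its own length it occurs only if the two are
rotations of each other. Ordered by length, the matrix of values of `masReal P` at `Q` is therefore
triangular with ones on the diagonal (`masReal_self`, `masReal_eq_zero_of_ne`). This gives
independence and uniqueness, and lets the coefficients of `f` be computed one length at a time. The
remainder after subtracting all patterns of length less than `n` vanishes on those patterns. Since
it is conjugation invariant, odd under transposition and additive on commuting elements, it vanishes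
on all words of length less than `n` (`residual_toPSL`). Elements not conjugate to a non-empty word
are torsion (`torsion_or_isConj`), where homogeneity forces the value zero. -/

theorem toPSL_nil : toPSL [] = 1 := rfl

theorem toPSL_append (v w : Word) : toPSL (v ++ w) = toPSL v * toPSL w := by
  simp only [toPSL, List.map_append, List.prod_append]
  rfl

theorem toPSL_cons (a : Bool) (w : Word) : toPSL (a :: w) = toPSL [a] * toPSL w :=
  toPSL_append [a] w

@[simp]
theorem transpose_nil : transpose [] = [] := rfl

@[simp]
theorem transpose_append (v w : Word) : transpose (v ++ w) = transpose w ++ transpose v := by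
  simp [transpose]

@[simp]
theorem transpose_singleton (a : Bool) : transpose [a] = [!a] := rfl

@[simp]
theorem transpose_transpose (w : Word) : transpose (transpose w) = w := by
  simp [transpose, Function.comp_def]

@[simp]
theorem length_transpose (w : Word) : (transpose w).length = w.length := by
  simp [transpose]

/-- The involution of `PSL₂(ℤ)` represented by the matrix `S = (0 -1; 1 0)`. -/
def flip : PSLZ := QuotientGroup.mk S

/-- Two elements of `SL₂(ℤ)` have the same class in `PSL₂(ℤ)` iff they agree up to sign. -/
theorem mk_eq_mk_iff (A B : Matrix.SpecialLinearGroup (Fin 2) ℤ) :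
    (QuotientGroup.mk A : PSLZ) = QuotientGroup.mk B ↔ B = A ∨ B = -A := by
  rw [QuotientGroup.eq, Matrix.SpecialLinearGroup.mem_center_iff]
  constructor
  · rintro ⟨r, hr, h⟩
    have hr' : r = 1 ∨ r = -1 := by
      rw [Fintype.card_fin] at hr
      exact Int.isUnit_iff.mp (IsUnit.of_pow_eq_one hr two_ne_zero)
    rcases hr' with rfl | rfl
    · left
      have : A⁻¹ * B = 1 := by
        ext i j
        rw [← h]
        simp
      exact (inv_mul_eq_one.mp this).symm
    · right
      have : A⁻¹ * B = -1 := by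
        apply Subtype.ext
        rw [← h]
        simp
      rw [inv_mul_eq_iff_eq_mul] at this
      simpa using this
  · rintro (rfl | rfl)
    · exact ⟨1, by simp, by simp⟩
    · exact ⟨-1, by simp, by simp⟩

theorem flip_mul_flip : flip * flip = 1 := by
  change (QuotientGroup.mk (S * S) : PSLZ) = QuotientGroup.mk 1
  rw [mk_eq_mk_iff]
  right
  decide

theorem flip_inv : flip⁻¹ = flip := inv_eq_of_mul_eq_one_right flip_mul_flip

/-- This relation and the next drive all reductions: across `flip`, opposite letters cancel and
equal letters merge into the other letter. -/
theorem toPSL_mul_flip_mul_toPSL_not (a : Bool) : toPSL [a] * flip * toPSL [!a] = flip := by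
  change (QuotientGroup.mk (([a].map letter).prod * S * ([!a].map letter).prod) : PSLZ)
    = QuotientGroup.mk S
  rw [mk_eq_mk_iff]
  left
  cases a <;> decide

theorem toPSL_mul_flip_mul_toPSL_self (a : Bool) : toPSL [a] * flip * toPSL [a] = toPSL [!a] := by
  change (QuotientGroup.mk (([a].map letter).prod * S * ([a].map letter).prod) : PSLZ)
    = QuotientGroup.mk ([!a].map letter).prod
  rw [mk_eq_mk_iff]
  cases a
  · right
    decide
  · left
    decide

theorem toPSL_mul_flip_mul_transpose (w : Word) :
    toPSL w * flip * toPSL (transpose w) = flip := by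
  induction w using List.reverseRecOn with
  | nil => simp [toPSL_nil]
  | append_singleton w a ih =>
    rw [transpose_append, toPSL_append, toPSL_append, transpose_singleton]
    calc _ = toPSL w * (toPSL [a] * flip * toPSL [!a]) * toPSL (transpose w) := by group
      _ = _ := by rw [toPSL_mul_flip_mul_toPSL_not, ih]

/-- Transposition is inversion up to conjugation, which is why asymmetries are the natural odd
invariants. -/
theorem toPSL_transpose (w : Word) : toPSL (transpose w) = flip * (toPSL w)⁻¹ * flip := by
  have h := toPSL_mul_flip_mul_transpose w
  rw [mul_assoc, ← eq_inv_mul_iff_mul_eq, ← eq_inv_mul_iff_mul_eq, flip_inv] at h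
  rw [h, mul_assoc]

theorem flip_mul_toPSL_pow_three (a : Bool) : (flip * toPSL [a]) ^ 3 = 1 := by
  have h₁ := toPSL_mul_flip_mul_toPSL_self a
  have h₂ := toPSL_mul_flip_mul_toPSL_not (!a)
  rw [Bool.not_not] at h₂
  calc (flip * toPSL [a]) ^ 3
      = flip * ((toPSL [a] * flip * toPSL [a]) * flip * toPSL [a]) := by
        simp only [pow_succ, pow_zero, one_mul, mul_assoc]
    _ = 1 := by rw [h₁, h₂, flip_mul_flip]

/-- The matrix of a word has positive diagonal, non-negative entries, and an entry sum that grows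
with the length of the word. -/
theorem entries_prod_letter (w : Word) :
    let M := (w.map letter).prod
    1 ≤ M 0 0 ∧ 0 ≤ M 0 1 ∧ 0 ≤ M 1 0 ∧ 1 ≤ M 1 1 ∧
      2 + (w.length : ℤ) ≤ M 0 0 + M 0 1 + M 1 0 + M 1 1 := by
  induction w with
  | nil => simp
  | cons a w ih =>
    obtain ⟨h₀₀, h₀₁, h₁₀, h₁₁, hs⟩ := ih
    have hmul : ∀ i j, ((a :: w).map letter).prod i j
        = letter a i 0 * (w.map letter).prod 0 j + letter a i 1 * (w.map letter).prod 1 j := by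
      intro i j
      rw [List.map_cons, List.prod_cons, Matrix.SpecialLinearGroup.coe_mul, Matrix.mul_apply,
        Fin.sum_univ_two]
    simp only [hmul, List.length_cons]
    push_cast
    cases a <;> simp [letter] <;> omega

/-- The matrix of a word has positive diagonal, whereas `S` and `-S` have zero diagonal. -/
theorem toPSL_ne_flip (w : Word) : toPSL w ≠ flip := by
  intro h
  obtain ⟨h₀₀, h₀₁, h₁₀, h₁₁, hs⟩ := entries_prod_letter w
  rcases (mk_eq_mk_iff _ _).mp h.symm with h | h <;> rw [h] at h₀₀ <;> revert h₀₀ <;> decide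

theorem eq_nil_of_toPSL_eq_one {w : Word} (h : toPSL w = 1) : w = [] := by
  obtain ⟨h₀₀, h₀₁, h₁₀, h₁₁, hs⟩ := entries_prod_letter w
  have h' : (QuotientGroup.mk 1 : PSLZ) = QuotientGroup.mk (w.map letter).prod := h.symm
  rcases (mk_eq_mk_iff _ _).mp h' with h | h
  · have hone : (1 : Matrix.SpecialLinearGroup (Fin 2) ℤ) 0 0
        + (1 : Matrix.SpecialLinearGroup (Fin 2) ℤ) 0 1
        + (1 : Matrix.SpecialLinearGroup (Fin 2) ℤ) 1 0
        + (1 : Matrix.SpecialLinearGroup (Fin 2) ℤ) 1 1 = 2 := by decide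
    rw [h, hone] at hs
    exact List.length_eq_zero_iff.mp (by omega)
  · rw [h] at h₀₀
    simp at h₀₀

/-- The subgroup of order two generated by `flip`. -/
abbrev flipGroup : Subgroup PSLZ := Subgroup.zpowers flip

theorem flip_mem_flipGroup : flip ∈ flipGroup := Subgroup.mem_zpowers flip

theorem mem_flipGroup {g : PSLZ} : g ∈ flipGroup ↔ g = 1 ∨ g = flip := by
  constructor
  · rintro ⟨k, rfl⟩
    have h2 : flip ^ (2 : ℤ) = 1 := by
      rw [zpow_ofNat, sq, flip_mul_flip]
    rcases Int.even_or_odd' k with ⟨m, rfl | rfl⟩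
    · left
      simp [zpow_mul, h2]
    · right
      simp [zpow_add, zpow_mul, h2]
  · rintro (rfl | rfl)
    · exact one_mem _
    · exact flip_mem_flipGroup

/-- The word `w` is the word of turns of `g`: up to `flip` on both sides, `g` is the element
represented by `w`. -/
def HasTurns (g : PSLZ) (w : Word) : Prop :=
  ∃ a ∈ flipGroup, ∃ b ∈ flipGroup, g = a * toPSL w * b

theorem hasTurns_toPSL (w : Word) : HasTurns (toPSL w) w :=
  ⟨1, one_mem _, 1, one_mem _, by simp⟩

theorem HasTurns.mul_mul {g : PSLZ} {w : Word} (h : HasTurns g w) {a b : PSLZ}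
    (ha : a ∈ flipGroup) (hb : b ∈ flipGroup) : HasTurns (a * g * b) w := by
  obtain ⟨c, hc, d, hd, rfl⟩ := h
  exact ⟨a * c, mul_mem ha hc, d * b, mul_mem hd hb, by simp only [mul_assoc]⟩

theorem HasTurns.inv {g : PSLZ} {w : Word} (h : HasTurns g w) : HasTurns g⁻¹ (transpose w) := by
  obtain ⟨a, ha, b, hb, rfl⟩ := h
  have : (a * toPSL w * b)⁻¹ = (b⁻¹ * flip) * toPSL (transpose w) * (flip * a⁻¹) := by
    rw [toPSL_transpose]
    calc _ = b⁻¹ * 1 * (toPSL w)⁻¹ * 1 * a⁻¹ := by group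
      _ = _ := by rw [← flip_mul_flip]; simp only [mul_assoc]
  rw [this]
  exact (hasTurns_toPSL _).mul_mul (mul_mem (inv_mem hb) flip_mem_flipGroup)
    (mul_mem flip_mem_flipGroup (inv_mem ha))

/-- Cancellation in a product of two words separated by `flip`. -/
theorem exists_hasTurns_mul_flip_mul (w v : Word) : ∃ x p y q z : Word,
    w = x ++ p ++ y ∧ v = transpose y ++ p ++ z ∧ p.length ≤ 1 ∧ q.length ≤ 1 ∧
      (q = [] → p = []) ∧ HasTurns (toPSL w * flip * toPSL v) (x ++ q ++ z) := by
  induction w using List.reverseRecOn generalizing v with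
  | nil =>
    refine ⟨[], [], [], [], v, rfl, rfl, by simp, by simp, by simp, ?_⟩
    simpa [toPSL_nil] using (hasTurns_toPSL v).mul_mul flip_mem_flipGroup (one_mem _)
  | append_singleton w a ih =>
    cases v with
    | nil =>
      refine ⟨w ++ [a], [], [], [], [], by simp, rfl, by simp, by simp, by simp, ?_⟩
      simpa [toPSL_nil] using (hasTurns_toPSL (w ++ [a])).mul_mul (one_mem _) flip_mem_flipGroup
    | cons b v =>
      have key : toPSL (w ++ [a]) * flip * toPSL (b :: v)
          = toPSL w * (toPSL [a] * flip * toPSL [b]) * toPSL v := by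
        rw [toPSL_append, toPSL_cons b]
        simp only [mul_assoc]
      rw [key]
      -- Equal letters merge and the reduction stops; opposite letters cancel and it continues
      -- inward. If one word runs out first, both `p` and `q` are empty.
      by_cases hab : b = a
      · subst hab
        refine ⟨w, [b], [], [!b], v, by simp, by simp, by simp, by simp, by simp, ?_⟩
        rw [toPSL_mul_flip_mul_toPSL_self, ← toPSL_append, ← toPSL_append]
        exact hasTurns_toPSL _
      · obtain rfl : b = !a := by cases a <;> cases b <;> simp_all
        rw [toPSL_mul_flip_mul_toPSL_not]
        obtain ⟨x, p, y, q, z, rfl, rfl, hp, hq, hpq, h⟩ := ih v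
        exact ⟨x, p, y ++ [a], q, z, by simp, by simp, hp, hq, hpq, h⟩

theorem eq_nil_of_hasTurns {g : PSLZ} (hg : g ∈ flipGroup) {w : Word} (h : HasTurns g w) :
    w = [] := by
  obtain ⟨a, ha, b, hb, rfl⟩ := h
  have hw : toPSL w ∈ flipGroup := by
    have := mul_mem (mul_mem (inv_mem ha) hg) (inv_mem hb)
    simpa [mul_assoc] using this
  rcases mem_flipGroup.mp hw with h | h
  · exact eq_nil_of_toPSL_eq_one h
  · exact absurd h (toPSL_ne_flip w)

/-- Dividing one representation by the other puts a product of `w` and `transpose v`, with or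
without `flip` between them, into `flipGroup`, where the only word of turns is empty. Without `flip`
both words are empty; with it, they must cancel completely. -/
theorem HasTurns.unique {g : PSLZ} {w v : Word} (hw : HasTurns g w) (hv : HasTurns g v) :
    w = v := by
  obtain ⟨a, ha, b, hb, rfl⟩ := hw
  obtain ⟨c, hc, d, hd, h⟩ := hv
  have key : toPSL w * (b * d⁻¹ * flip) * toPSL (transpose v) ∈ flipGroup := by
    have : toPSL w * (b * d⁻¹ * flip) * toPSL (transpose v) = a⁻¹ * c * flip := by
      have h' : toPSL w = a⁻¹ * (c * toPSL v * d) * b⁻¹ := by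
        rw [← h]
        group
      rw [toPSL_transpose, h']
      calc _ = a⁻¹ * c * toPSL v * (flip * flip) * (toPSL v)⁻¹ * flip := by group
        _ = _ := by rw [flip_mul_flip]; group
    rw [this]
    exact mul_mem (mul_mem (inv_mem ha) hc) flip_mem_flipGroup
  rcases mem_flipGroup.mp
    (mul_mem (mul_mem hb (inv_mem hd)) flip_mem_flipGroup) with h₁ | h₁ <;> rw [h₁] at key
  · rw [mul_one, ← toPSL_append] at key
    have := eq_nil_of_hasTurns key (hasTurns_toPSL _)
    obtain ⟨h₂, h₃⟩ := List.append_eq_nil_iff.mp this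
    have h₃ := congrArg List.length h₃
    rw [length_transpose] at h₃
    rw [h₂, List.length_eq_zero_iff.mp h₃]
  · obtain ⟨x, p, y, q, z, rfl, hv, -, -, hpq, ht⟩ := exists_hasTurns_mul_flip_mul w (transpose v)
    have := eq_nil_of_hasTurns key ht
    obtain ⟨h₂, h₃⟩ := List.append_eq_nil_iff.mp this
    obtain ⟨h₂, h₄⟩ := List.append_eq_nil_iff.mp h₂
    have hv' := congrArg transpose hv
    rw [transpose_transpose] at hv'
    simp [hv', hpq h₄, h₂, h₃]

/-- The word of turns of a product. -/
theorem HasTurns.exists_mul {g h : PSLZ} {w v : Word} (hg : HasTurns g w) (hh : HasTurns h v) :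
    HasTurns (g * h) (w ++ v) ∨ ∃ x p y q z : Word,
      w = x ++ p ++ y ∧ v = transpose y ++ p ++ z ∧ p.length ≤ 1 ∧ q.length ≤ 1 ∧
      HasTurns (g * h) (x ++ q ++ z) := by
  obtain ⟨a, ha, b, hb, rfl⟩ := hg
  obtain ⟨c, hc, d, hd, rfl⟩ := hh
  have key : a * toPSL w * b * (c * toPSL v * d) = a * (toPSL w * (b * c) * toPSL v) * d := by
    group
  rw [key]
  rcases mem_flipGroup.mp (mul_mem hb hc) with h | h <;> rw [h]
  · left
    rw [mul_one, ← toPSL_append]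
    exact (hasTurns_toPSL _).mul_mul ha hd
  · right
    obtain ⟨x, p, y, q, z, hw, hv, hp, hq, -, ht⟩ := exists_hasTurns_mul_flip_mul w v
    exact ⟨x, p, y, q, z, hw, hv, hp, hq, ht.mul_mul ha hd⟩

/-- The generators `S` and `T` have turns `[]` and `[true]`, and having turns is stable under
products and inverses. -/
theorem exists_hasTurns (g : PSLZ) : ∃ w, HasTurns g w := by
  induction g using QuotientGroup.induction_on with
  | H A =>
  have hA : A ∈ Subgroup.closure {S, T} := by
    simp [SpecialLinearGroup.SL2Z_generators]
  induction hA using Subgroup.closure_induction with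
  | mem A hA =>
    rcases hA with rfl | rfl
    · exact ⟨[], flip, flip_mem_flipGroup, 1, one_mem _, by rw [toPSL_nil, mul_one, mul_one]; rfl⟩
    · refine ⟨[true], ?_⟩
      convert hasTurns_toPSL [true] using 1
      simp only [toPSL]
      congr 1
      decide
  | one => exact ⟨[], hasTurns_toPSL []⟩
  | mul A B _ _ hA hB =>
    obtain ⟨w, hw⟩ := hA
    obtain ⟨v, hv⟩ := hB
    rcases hw.exists_mul hv with h | ⟨x, p, y, q, z, -, -, -, -, h⟩
    · exact ⟨_, h⟩
    · exact ⟨_, h⟩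
  | inv A _ hA =>
    obtain ⟨w, hw⟩ := hA
    exact ⟨_, hw.inv⟩

/-! ### Conjugacy classes: torsion or a non-empty word. -/

theorem pow_eq_one_of_isConj {g h : PSLZ} (hc : IsConj g h) {n : ℕ} (hg : g ^ n = 1) :
    h ^ n = 1 := by
  obtain ⟨c, rfl⟩ := isConj_iff.mp hc
  rw [conj_pow, hg, mul_one, mul_inv_cancel]

/-- An element `flip * toPSL w` has finite order, or is conjugate to a non-empty word. -/
theorem flip_mul_toPSL_torsion_or_isConj (w : Word) :
    (∃ n, 0 < n ∧ (flip * toPSL w) ^ n = 1) ∨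
      ∃ v : Word, v ≠ [] ∧ IsConj (toPSL v) (flip * toPSL w) := by
  induction hn : w.length using Nat.strong_induction_on generalizing w with
  | _ n ih =>
  rcases w with _ | ⟨a, w⟩
  · exact Or.inl ⟨2, by simp, by rw [toPSL_nil, mul_one, sq, flip_mul_flip]⟩
  rcases List.eq_nil_or_concat' w with rfl | ⟨u, b, rfl⟩
  · exact Or.inl ⟨3, by simp, flip_mul_toPSL_pow_three a⟩
  -- Conjugation brings the last letter in front of `flip`. If it equals `a`, the merge removes
  -- `flip` and leaves a word; otherwise the two letters cancel and the shorter `flip * toPSL u`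
  -- remains.
  have hconj : IsConj (toPSL [b] * flip * toPSL [a] * toPSL u)
      (flip * toPSL (a :: (u ++ [b]))) := by
    rw [isConj_iff]
    refine ⟨(toPSL [b])⁻¹, ?_⟩
    rw [toPSL_cons a (u ++ [b]), toPSL_append]
    group
  by_cases hab : a = b
  · subst hab
    rw [toPSL_mul_flip_mul_toPSL_self, ← toPSL_append] at hconj
    exact Or.inr ⟨_, by simp, hconj⟩
  · obtain rfl : a = !b := by cases a <;> cases b <;> simp_all
    rw [toPSL_mul_flip_mul_toPSL_not] at hconj
    rcases ih u.length (by simp at hn; omega) u rfl with ⟨m, hm, h⟩ | ⟨v, hv, h⟩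
    · exact Or.inl ⟨m, hm, pow_eq_one_of_isConj hconj h⟩
    · exact Or.inr ⟨v, hv, h.trans hconj⟩

/-- Every element of `PSL₂(ℤ)` has finite order or is conjugate to a non-empty word. -/
theorem torsion_or_isConj (g : PSLZ) :
    (∃ n, 0 < n ∧ g ^ n = 1) ∨ ∃ w : Word, w ≠ [] ∧ IsConj (toPSL w) g := by
  obtain ⟨w, a, ha, b, hb, rfl⟩ := exists_hasTurns g
  have hconj : IsConj ((b * a) * toPSL w) (a * toPSL w * b) := by
    rw [isConj_iff]
    exact ⟨b⁻¹, by group⟩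
  rcases mem_flipGroup.mp (mul_mem hb ha) with h | h <;> rw [h] at hconj
  · rw [one_mul] at hconj
    by_cases hw : w = []
    · subst hw
      exact Or.inl ⟨1, one_pos, pow_eq_one_of_isConj hconj (by simp [toPSL_nil])⟩
    · exact Or.inr ⟨w, hw, hconj⟩
  · rcases flip_mul_toPSL_torsion_or_isConj w with ⟨m, hm, h⟩ | ⟨v, hv, h⟩
    · exact Or.inl ⟨m, hm, pow_eq_one_of_isConj hconj h⟩
    · exact Or.inr ⟨v, hv, h.trans hconj⟩

end ModularWord

/-! ### Counting occurrences of a pattern, linearly and cyclically. -/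

namespace ModularWord

/-- The word `P` occurs in the word `w` at the position `j`. -/
def Occurs (P w : Word) (j : ℕ) : Prop := ∀ i < P.length, w[j + i]? = P[i]?

instance (P w : Word) : DecidablePred (Occurs P w) := fun j =>
  inferInstanceAs (Decidable (∀ i < P.length, w[j + i]? = P[i]?))

/-- The number of occurrences of `P` in `w`, where `w` is not continued periodically. -/
def linearOcc (P w : Word) : ℕ := Nat.count (Occurs P w) w.length

theorem count_le_count_add {p q : ℕ → Prop} [DecidablePred p] [DecidablePred q] {m n : ℕ}
    (h : ∀ k, k + m ≤ n → q k → p k) : Nat.count q n ≤ Nat.count p n + m := by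
  rcases le_total n m with hnm | hnm
  · exact (Nat.count_le _).trans (hnm.trans (Nat.le_add_left _ _))
  · obtain ⟨a, rfl⟩ := Nat.exists_eq_add_of_le' hnm
    rw [Nat.count_add q]
    refine add_le_add ?_ (Nat.count_le _)
    calc Nat.count q a ≤ Nat.count p a := Nat.count_mono_left fun k hk => h k (by omega)
      _ ≤ Nat.count p (a + m) := Nat.count_monotone p (Nat.le_add_right a m)

theorem count_mul_of_periodic {p : ℕ → Prop} [DecidablePred p] {a : ℕ}
    (h : ∀ k, p (a + k) ↔ p k) (n : ℕ) : Nat.count p (n * a) = n * Nat.count p a := by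
  induction n with
  | zero => simp
  | succ n ih =>
    rw [Nat.succ_mul, Nat.succ_mul, add_comm, Nat.count_add]
    simp only [h]
    rw [ih, add_comm]

/-- The extra occurrences straddle the cut, so they start among the last `P.length` positions of
`x`. -/
theorem linearOcc_append_bounds (P x y : Word) :
    linearOcc P x + linearOcc P y ≤ linearOcc P (x ++ y) ∧
      linearOcc P (x ++ y) ≤ linearOcc P x + linearOcc P y + P.length := by
  have hy : Nat.count (fun k => Occurs P (x ++ y) (x.length + k)) y.length = linearOcc P y := by
    unfold linearOcc
    congr 1
    funext k
    simp only [Occurs, add_assoc, List.getElem?_append_right (Nat.le_add_right _ _),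
      Nat.add_sub_cancel_left]
  have hxy : linearOcc P (x ++ y)
      = Nat.count (Occurs P (x ++ y)) x.length + linearOcc P y := by
    rw [← hy, ← Nat.count_add, ← List.length_append]
    rfl
  have hle : linearOcc P x ≤ Nat.count (Occurs P (x ++ y)) x.length := by
    refine Nat.count_mono_left fun k _ hk i hi => ?_
    have h := hk i hi
    have hlt : k + i < x.length := by
      by_contra hge
      rw [List.getElem?_eq_none (by omega), List.getElem?_eq_getElem hi] at h
      exact absurd h (by simp)
    rw [List.getElem?_append_left hlt, h]
  have hge : Nat.count (Occurs P (x ++ y)) x.length ≤ linearOcc P x + P.length := by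
    refine count_le_count_add fun k hk h i hi => ?_
    rw [← h i hi, List.getElem?_append_left (by omega)]
  omega

theorem getElem?_transpose {w : Word} {k : ℕ} (hk : k < w.length) :
    (transpose w)[k]? = w[w.length - 1 - k]?.map not := by
  rw [transpose, List.getElem?_reverse (by simpa using hk), List.getElem?_map, List.length_map]

theorem transpose_ne_nil {P : Word} (hP : P ≠ []) : transpose P ≠ [] := by
  intro h
  have := congrArg List.length h
  rw [length_transpose] at this
  exact hP (List.length_eq_zero_iff.mp this)

theorem Occurs.add_length_le {P w : Word} (hP : P ≠ []) {j : ℕ} (h : Occurs P w j) :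
    j + P.length ≤ w.length := by
  have hpos := List.length_pos_iff.mpr hP
  have h' := h (P.length - 1) (by omega)
  by_contra hlt
  rw [List.getElem?_eq_none (by omega), List.getElem?_eq_getElem (by omega)] at h'
  exact absurd h' (by simp)

/-- Reversal sends an occurrence at `j` to one at `w.length - P.length - j`, injectively. -/
theorem linearOcc_le_transpose {P : Word} (hP : P ≠ []) (w : Word) :
    linearOcc P w ≤ linearOcc (transpose P) (transpose w) := by
  have hpos := List.length_pos_iff.mpr hP
  unfold linearOcc
  rw [Nat.count_eq_card_filter_range, Nat.count_eq_card_filter_range]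
  refine Finset.card_le_card_of_injOn (fun j => w.length - P.length - j) ?_ ?_
  · intro j hj
    simp only [Finset.coe_filter, Finset.mem_range, Set.mem_ofPred_eq, length_transpose] at hj ⊢
    have hlen := hj.2.add_length_le hP
    refine ⟨by omega, fun i hi => ?_⟩
    rw [length_transpose] at hi
    rw [getElem?_transpose (by omega), getElem?_transpose hi,
      ← hj.2 (P.length - 1 - i) (by omega)]
    congr 2
    omega
  · intro j hj k hk h
    simp only [Finset.coe_filter, Finset.mem_range, Set.mem_ofPred_eq] at hj hk h
    have := hj.2.add_length_le hP
    have := hk.2.add_length_le hP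
    omega

theorem linearOcc_transpose {P : Word} (hP : P ≠ []) (w : Word) :
    linearOcc (transpose P) (transpose w) = linearOcc P w := by
  refine le_antisymm ?_ (linearOcc_le_transpose hP w)
  simpa using linearOcc_le_transpose (transpose_ne_nil hP) (transpose w)

theorem periodic_length_add (w : Word) (k : ℕ) : periodic w (w.length + k) = periodic w k := by
  simp [periodic]

theorem getElem?_eq_periodic {w : Word} {k : ℕ} (hk : k < w.length) :
    w[k]? = some (periodic w k) := by
  rw [periodic, Nat.mod_eq_of_lt hk, List.getD_eq_getElem?_getD, List.getElem?_eq_getElem hk]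
  rfl

theorem getElem?_flatten_replicate {w : Word} {n k : ℕ} (hk : k < n * w.length) :
    (List.replicate n w).flatten[k]? = some (periodic w k) := by
  induction n generalizing k with
  | zero => simp at hk
  | succ n ih =>
    rw [Nat.succ_mul] at hk
    rw [List.replicate_succ, List.flatten_cons]
    rcases lt_or_ge k w.length with h | h
    · rw [List.getElem?_append_left h, getElem?_eq_periodic h]
    · obtain ⟨k, rfl⟩ := Nat.exists_eq_add_of_le h
      rw [List.getElem?_append_right h, Nat.add_sub_cancel_left, ih (by omega),
        periodic_length_add]

theorem occ_eq_count (P w : Word) :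
    occ P w = Nat.count (fun j => ∀ i : Fin P.length, P.get i = periodic w (j + i)) w.length := by
  rw [Nat.count_eq_card_filter_range]
  rfl

/-- Over `n` periods, cyclic matches exceed linear ones only near the right end, where `P` may
overrun. -/
theorem linearOcc_flatten_replicate_bounds (P w : Word) (n : ℕ) :
    linearOcc P (List.replicate n w).flatten ≤ n * occ P w ∧
      n * occ P w ≤ linearOcc P (List.replicate n w).flatten + P.length := by
  have hlen : (List.replicate n w).flatten.length = n * w.length := by simp
  rw [occ_eq_count, ← count_mul_of_periodic (fun k => by simp only [add_assoc,
    periodic_length_add]), linearOcc, hlen]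
  constructor
  · refine Nat.count_mono_left fun k hk h i => ?_
    have h' := h i i.2
    have hlt : k + i < n * w.length := by
      by_contra hge
      rw [List.getElem?_eq_none (by omega), List.getElem?_eq_getElem i.2] at h'
      exact absurd h' (by simp)
    rw [getElem?_flatten_replicate hlt, List.getElem?_eq_getElem i.2] at h'
    simpa using h'.symm
  · refine count_le_count_add fun k hk h i hi => ?_
    rw [getElem?_flatten_replicate (by omega), List.getElem?_eq_getElem hi]
    simpa using (h ⟨i, hi⟩).symm

theorem toPSL_flatten_replicate (w : Word) (n : ℕ) :
    toPSL (List.replicate n w).flatten = toPSL w ^ n := by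
  induction n with
  | zero => rfl
  | succ n ih => rw [List.replicate_succ, List.flatten_cons, toPSL_append, ih, pow_succ']

/-- The word of turns of an element of `PSL₂(ℤ)`. -/
noncomputable def turns (g : PSLZ) : Word := (exists_hasTurns g).choose

theorem hasTurns_turns (g : PSLZ) : HasTurns g (turns g) := (exists_hasTurns g).choose_spec

theorem HasTurns.turns_eq {g : PSLZ} {w : Word} (h : HasTurns g w) : turns g = w :=
  (hasTurns_turns g).unique h

/-- A function on words that is additive up to a bounded error, and odd with respect to
transposition, defines a quasi-morphism on `PSL₂(ℤ)`. -/
theorem defect_comp_turns_le {ψ : Word → ℝ} {K : ℝ}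
    (hadd : ∀ x y, |ψ (x ++ y) - ψ x - ψ y| ≤ K) (hodd : ∀ w, ψ (transpose w) = -ψ w)
    (hletter : ∀ w, w.length ≤ 1 → |ψ w| ≤ K) (A B : PSLZ) :
    |ψ (turns B) - ψ (turns (A * B)) + ψ (turns A)| ≤ 9 * K := by
  have hK : 0 ≤ K := (abs_nonneg _).trans (hadd [] [])
  rcases (hasTurns_turns A).exists_mul (hasTurns_turns B) with
    h | ⟨x, p, y, q, z, hA, hB, hp, hq, h⟩
  · rw [h.turns_eq]
    have := abs_le.mp (hadd (turns A) (turns B))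
    exact abs_le.mpr ⟨by linarith, by linarith⟩
  -- Six splittings cost `6 * K`; oddness removes `y`, and the remaining `2 ψ p - ψ q` costs `3 *
  -- K`.
  · rw [h.turns_eq, hA, hB]
    have h₁ := abs_le.mp (hadd (x ++ p) y)
    have h₂ := abs_le.mp (hadd x p)
    have h₃ := abs_le.mp (hadd (transpose y ++ p) z)
    have h₄ := abs_le.mp (hadd (transpose y) p)
    have h₅ := abs_le.mp (hadd (x ++ q) z)
    have h₆ := abs_le.mp (hadd x q)
    have h₇ := abs_le.mp (hletter p hp)
    have h₈ := abs_le.mp (hletter q hq)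
    rw [hodd] at h₄
    exact abs_le.mpr ⟨by linarith, by linarith⟩

/-! ### Homogenization, and the asymmetries as homogeneous quasi-morphisms. -/

theorem nonpos_of_forall_nat_mul_le {x C : ℝ} (h : ∀ n : ℕ, n * x ≤ C) : x ≤ 0 := by
  by_contra! hx
  obtain ⟨n, hn⟩ := exists_nat_gt (C / x)
  rw [div_lt_iff₀ hx] at hn
  exact absurd (h n) (not_le.mpr hn)

/-- The homogenization of a quasi-morphism is a homogeneous quasi-morphism. -/
theorem mem_PX_of_homogenization {G : Type*} [Group G] {φ m : G → ℝ} {D : ℝ}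
    (hφ : ∀ A B, |φ B - φ (A * B) + φ A| ≤ D)
    (hm : ∀ A, ∃ C : ℝ, ∀ n : ℕ, |φ (A ^ n) - n * m A| ≤ C) : m ∈ PX G := by
  have hpow : ∀ A (n : ℕ), |φ (A ^ n) - n * φ A| ≤ (n + 1) * D := by
    intro A n
    induction n with
    | zero =>
      have := hφ 1 1
      simpa using this
    | succ n ih =>
      have h₁ := abs_le.mp (hφ (A ^ n) A)
      rw [← pow_succ] at h₁
      have h₂ := abs_le.mp ih
      push_cast
      exact abs_le.mpr ⟨by linarith, by linarith⟩
  have hclose : ∀ A, |m A - φ A| ≤ D := by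
    intro A
    obtain ⟨C, hC⟩ := hm A
    have : ∀ n : ℕ, n * (|m A - φ A| - D) ≤ C + D := by
      intro n
      have h₁ := abs_le.mp (hC n)
      have h₂ := abs_le.mp (hpow A n)
      have : |(n : ℝ) * (m A - φ A)| ≤ C + (n + 1) * D :=
        abs_le.mpr ⟨by linarith, by linarith⟩
      rw [abs_mul, Nat.abs_cast] at this
      linarith
    linarith [nonpos_of_forall_nat_mul_le this]
  -- One `D` for the defect of `φ`, and one for each of three replacements of `φ` by `m`.
  refine ⟨⟨4 * D, fun A B => ?_⟩, fun A n => ?_⟩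
  · have h₁ := abs_le.mp (hφ A B)
    have h₂ := abs_le.mp (hclose A)
    have h₃ := abs_le.mp (hclose B)
    have h₄ := abs_le.mp (hclose (A * B))
    exact abs_le.mpr ⟨by linarith, by linarith⟩
  · obtain ⟨C, hC⟩ := hm A
    obtain ⟨C', hC'⟩ := hm (A ^ n)
    have : ∀ k : ℕ, k * |m (A ^ n) - n * m A| ≤ C + C' := by
      intro k
      have h₁ := abs_le.mp (hC (n * k))
      have h₂ := abs_le.mp (hC' k)
      rw [← pow_mul] at h₂
      push_cast at h₁
      rw [← Nat.abs_cast k, ← abs_mul]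
      exact abs_le.mpr ⟨by linarith, by linarith⟩
    have := abs_nonpos_iff.mp (nonpos_of_forall_nat_mul_le this)
    linarith

/-- The bound does not depend on `g`, so it can be applied to all powers of an element at once. -/
theorem abs_conj_sub_le {G : Type*} [Group G] {φ : G → ℝ} {D : ℝ}
    (hφ : ∀ A B, |φ B - φ (A * B) + φ A| ≤ D) (g h : G) :
    |φ (h * g * h⁻¹) - φ g| ≤ 2 * D + |φ h| + |φ h⁻¹| := by
  have h₁ := abs_le.mp (hφ (h * g) h⁻¹)
  have h₂ := abs_le.mp (hφ h g)
  have h₃ := abs_le.mp (le_refl |φ h|)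
  have h₄ := abs_le.mp (le_refl |φ h⁻¹|)
  exact abs_le.mpr ⟨by linarith, by linarith⟩

/-- The asymmetry of the linear occurrences of a pattern. -/
def linearAsymmetry (P w : Word) : ℝ := linearOcc P w - linearOcc (transpose P) w

theorem abs_linearAsymmetry_append_le (P x y : Word) :
    |linearAsymmetry P (x ++ y) - linearAsymmetry P x - linearAsymmetry P y| ≤ P.length := by
  obtain ⟨h₁, h₂⟩ := linearOcc_append_bounds P x y
  obtain ⟨h₃, h₄⟩ := linearOcc_append_bounds (transpose P) x y
  rw [length_transpose] at h₄
  rify at h₁ h₂ h₃ h₄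
  unfold linearAsymmetry
  exact abs_le.mpr ⟨by linarith, by linarith⟩

theorem linearAsymmetry_transpose {P : Word} (hP : P ≠ []) (w : Word) :
    linearAsymmetry P (transpose w) = -linearAsymmetry P w := by
  have h₁ := linearOcc_transpose hP w
  have h₂ := linearOcc_transpose (transpose_ne_nil hP) w
  rw [transpose_transpose] at h₂
  rw [linearAsymmetry, linearAsymmetry, h₁, h₂]
  ring

theorem abs_linearAsymmetry_le_of_length_le_one {P : Word} (hP : P ≠ []) {w : Word}
    (hw : w.length ≤ 1) : |linearAsymmetry P w| ≤ P.length := by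
  have hpos : 1 ≤ P.length := List.length_pos_iff.mpr hP
  have h₁ : linearOcc P w ≤ P.length := (Nat.count_le _).trans (hw.trans hpos)
  have h₂ : linearOcc (transpose P) w ≤ P.length := (Nat.count_le _).trans (hw.trans hpos)
  rify at h₁ h₂
  have h₃ : (0 : ℝ) ≤ linearOcc P w := Nat.cast_nonneg _
  have h₄ : (0 : ℝ) ≤ linearOcc (transpose P) w := Nat.cast_nonneg _
  unfold linearAsymmetry
  exact abs_le.mpr ⟨by linarith, by linarith⟩

theorem defect_linearAsymmetry_le {P : Word} (hP : P ≠ []) (A B : PSLZ) :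
    |linearAsymmetry P (turns B) - linearAsymmetry P (turns (A * B))
      + linearAsymmetry P (turns A)| ≤ 9 * P.length :=
  defect_comp_turns_le (abs_linearAsymmetry_append_le P) (linearAsymmetry_transpose hP)
    (fun _ => abs_linearAsymmetry_le_of_length_le_one hP) A B

theorem linearAsymmetry_pow_isConj {P : Word} (hP : P ≠ []) {w : Word} {A : PSLZ}
    (h : IsConj (toPSL w) A) : ∃ C : ℝ, ∀ n : ℕ,
      |linearAsymmetry P (turns (A ^ n)) - n * ((occ P w : ℝ) - occ (transpose P) w)| ≤ C := by
  obtain ⟨c, rfl⟩ := isConj_iff.mp h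
  refine ⟨2 * (9 * P.length) + |linearAsymmetry P (turns c)| + |linearAsymmetry P (turns c⁻¹)|
    + P.length, fun n => ?_⟩
  have h₁ := abs_conj_sub_le (φ := fun A => linearAsymmetry P (turns A))
    (defect_linearAsymmetry_le hP) (toPSL w ^ n) c
  rw [← conj_pow, ← toPSL_flatten_replicate, (hasTurns_toPSL _).turns_eq] at h₁
  have h₂ : |linearAsymmetry P (List.replicate n w).flatten
      - n * ((occ P w : ℝ) - occ (transpose P) w)| ≤ P.length := by
    obtain ⟨h₁, h₂⟩ := linearOcc_flatten_replicate_bounds P w n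
    obtain ⟨h₃, h₄⟩ := linearOcc_flatten_replicate_bounds (transpose P) w n
    rw [length_transpose] at h₄
    rify at h₁ h₂ h₃ h₄
    unfold linearAsymmetry
    exact abs_le.mpr ⟨by linarith, by linarith⟩
  have h₁ := abs_le.mp h₁
  have h₂ := abs_le.mp h₂
  exact abs_le.mpr ⟨by linarith, by linarith⟩

theorem linearAsymmetry_pow_torsion (P : Word) {A : PSLZ} {k : ℕ} (hk : 0 < k)
    (hA : A ^ k = 1) : ∃ C : ℝ, ∀ n : ℕ, |linearAsymmetry P (turns (A ^ n))| ≤ C := by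
  refine ⟨∑ i ∈ Finset.range k, |linearAsymmetry P (turns (A ^ i))|, fun n => ?_⟩
  have : A ^ n = A ^ (n % k) := by
    conv_lhs => rw [← Nat.div_add_mod n k, pow_add, pow_mul, hA, one_pow, one_mul]
  rw [this]
  exact Finset.single_le_sum (f := fun i => |linearAsymmetry P (turns (A ^ i))|)
    (fun i _ => abs_nonneg _) (Finset.mem_range.mpr (Nat.mod_lt n hk))

theorem linearAsymmetry_pow_masReal {P : Word} (hP : P ≠ []) (A : PSLZ) :
    ∃ C : ℝ, ∀ n : ℕ, |linearAsymmetry P (turns (A ^ n)) - n * masReal P A| ≤ C := by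
  by_cases h : ∃ w : Word, w ≠ [] ∧ IsConj (toPSL w) A
  · have hmas : masReal P A = (occ P h.choose : ℝ) - occ (transpose P) h.choose := by
      rw [masReal, mas, dif_pos h]
      push_cast
      rfl
    rw [hmas]
    exact linearAsymmetry_pow_isConj hP h.choose_spec.2
  · have hmas : masReal P A = 0 := by
      rw [masReal, mas, dif_neg h, Int.cast_zero]
    obtain ⟨k, hk, hA⟩ := (torsion_or_isConj A).resolve_right h
    simpa [hmas] using linearAsymmetry_pow_torsion P hk hA

theorem masReal_mem_PX {P : Word} (hP : P ≠ []) : masReal P ∈ PX PSLZ :=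
  mem_PX_of_homogenization (φ := fun A => linearAsymmetry P (turns A))
    (defect_linearAsymmetry_le hP) (linearAsymmetry_pow_masReal hP)

/-- The asymmetry may be computed on any word that represents the conjugacy class. -/
theorem masReal_eq_of_isConj {P : Word} (hP : P ≠ []) {w : Word} {A : PSLZ}
    (h : IsConj (toPSL w) A) : masReal P A = (occ P w : ℝ) - occ (transpose P) w := by
  obtain ⟨C, hC⟩ := linearAsymmetry_pow_masReal hP A
  obtain ⟨C', hC'⟩ := linearAsymmetry_pow_isConj hP h
  -- Both numbers are growth rates of the same sequence, so uniqueness of `w` up to rotation is not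
  -- needed.
  have : ∀ n : ℕ, n * |masReal P A - ((occ P w : ℝ) - occ (transpose P) w)| ≤ C + C' := by
    intro n
    have h₁ := abs_le.mp (hC n)
    have h₂ := abs_le.mp (hC' n)
    rw [← Nat.abs_cast n, ← abs_mul]
    exact abs_le.mpr ⟨by linarith, by linarith⟩
  exact sub_eq_zero.mp (abs_nonpos_iff.mp (nonpos_of_forall_nat_mul_le this))

end ModularWord

/-! ### Invariance properties of homogeneous quasi-morphisms. -/

namespace ModularWord

section PX

variable {G : Type*} [Group G] {f : G → ℝ}

theorem map_one_of_mem_PX (hf : f ∈ PX G) : f 1 = 0 := by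
  simpa using hf.2 1 0

theorem map_eq_zero_of_pow_eq_one (hf : f ∈ PX G) {A : G} {n : ℕ} (hn : 0 < n)
    (hA : A ^ n = 1) : f A = 0 := by
  have h := hf.2 A n
  rw [hA, map_one_of_mem_PX hf] at h
  rcases mul_eq_zero.mp h.symm with h | h
  · exact absurd (Nat.cast_eq_zero.mp h) hn.ne'
  · exact h

/-- For commuting elements, the defect at `A ^ n` and `B ^ n` is `n` times the defect at `A` and
`B`, yet stays bounded. -/
theorem map_mul_of_commute (hf : f ∈ PX G) {A B : G} (h : Commute A B) :
    f (A * B) = f A + f B := by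
  obtain ⟨D, hD⟩ := hf.1
  have : ∀ n : ℕ, n * |f B - f (A * B) + f A| ≤ D := by
    intro n
    have h' := hD (A ^ n) (B ^ n)
    rw [← h.mul_pow, hf.2, hf.2, hf.2] at h'
    rw [← Nat.abs_cast n, ← abs_mul]
    rwa [show (n : ℝ) * (f B - f (A * B) + f A) = n * f B - n * f (A * B) + n * f A by ring]
  linarith [abs_nonpos_iff.mp (nonpos_of_forall_nat_mul_le this)]

theorem map_inv_of_mem_PX (hf : f ∈ PX G) (A : G) : f A⁻¹ = -f A := by
  have h := map_mul_of_commute hf (Commute.refl A).inv_right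
  rw [mul_inv_cancel, map_one_of_mem_PX hf] at h
  linarith

theorem map_eq_of_isConj (hf : f ∈ PX G) {A B : G} (h : IsConj A B) : f A = f B := by
  obtain ⟨c, rfl⟩ := isConj_iff.mp h
  obtain ⟨D, hD⟩ := hf.1
  have : ∀ n : ℕ, n * |f (c * A * c⁻¹) - f A| ≤ 2 * D + |f c| + |f c⁻¹| := by
    intro n
    have h' := abs_conj_sub_le hD (A ^ n) c
    rw [← conj_pow, hf.2, hf.2, ← mul_sub, abs_mul, Nat.abs_cast] at h'
    exact h'
  linarith [abs_nonpos_iff.mp (nonpos_of_forall_nat_mul_le this)]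

end PX

theorem isConj_toPSL_of_isRotated {v w : Word} (h : v ~r w) : IsConj (toPSL v) (toPSL w) := by
  obtain ⟨n, hn, rfl⟩ := List.isRotated_iff_mod.mp h
  rw [List.rotate_eq_drop_append_take hn, isConj_iff]
  refine ⟨(toPSL (v.take n))⁻¹, ?_⟩
  conv_lhs => rw [← List.take_append_drop n v, toPSL_append]
  simp [toPSL_append]

theorem map_toPSL_transpose {f : PSLZ → ℝ} (hf : f ∈ PX PSLZ) (w : Word) :
    f (toPSL (transpose w)) = -f (toPSL w) := by
  rw [← map_inv_of_mem_PX hf]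
  refine (map_eq_of_isConj hf (isConj_iff.mpr ⟨flip, ?_⟩)).symm
  rw [toPSL_transpose, flip_inv]

/-! ### Lyndon words and their cyclic occurrences. -/

theorem append_lt_append_of_lt {x y : Word} (hlen : x.length = y.length) (h : x < y)
    (a b : Word) : x ++ a < y ++ b := by
  induction x generalizing y with
  | nil =>
    rw [List.length_eq_zero_iff.mp hlen.symm] at h
    exact absurd h (List.not_lt_nil _)
  | cons c x ih =>
    cases y with
    | nil => simp at hlen
    | cons d y =>
      rw [List.cons_append, List.cons_append, List.cons_lt_cons_iff]
      rcases List.cons_lt_cons_iff.mp h with h | ⟨h, h'⟩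
      · exact Or.inl h
      · exact Or.inr ⟨h, ih (by simpa using hlen) h'⟩

/-- A Lyndon word has no period smaller than its length. -/
theorem not_period_of_mem_lyndonWords {P : Word} (hP : P ∈ lyndonWords) {p : ℕ} (hp : 0 < p)
    (hlt : p < P.length) : ¬ ∀ i, i + p < P.length → P[i]? = P[i + p]? := by
  intro h
  have hx : P.drop p = P.take (P.length - p) := by
    apply List.ext_getElem?
    intro i
    rw [List.getElem?_drop, List.getElem?_take]
    split_ifs with hi
    · rw [h i (by omega), add_comm]
    · exact List.getElem?_eq_none (by omega)
  have h₁ := hP p hp hlt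
  have h₂ := hP (P.length - p) (by omega) (by omega)
  rw [List.rotate_eq_drop_append_take (by omega)] at h₁ h₂
  rw [← hx] at h₂
  have hlen : (P.take p).length = (P.drop (P.length - p)).length := by
    rw [List.length_take, List.length_drop]
    omega
  -- With border `b`, `P = a ++ b = b ++ c`. The Lyndon condition gives `b ++ a < b ++ c` and `c ++
  -- b < a ++ b`, which are incompatible since `a` and `c` have equal length.
  have hP₁ : P = P.drop p ++ P.drop (P.length - p) := by
    rw [hx, List.take_append_drop]
  have hP₂ : P = P.take p ++ P.drop p := (List.take_append_drop p P).symm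
  rcases lt_trichotomy (P.take p) (P.drop (P.length - p)) with h₃ | h₃ | h₃
  · have := append_lt_append_of_lt hlen h₃ (P.drop p) (P.drop p)
    rw [← hP₂] at this
    exact lt_asymm this h₂
  · rw [← h₃, ← hP₂] at h₂
    exact lt_irrefl _ h₂
  · have := List.append_left_lt (l₁ := P.drop p) h₃
    rw [← hP₁] at this
    exact lt_asymm this h₁

theorem occ_eq_zero_of_forall {P w : Word}
    (h : ∀ j, ¬ ∀ i : Fin P.length, P.get i = periodic w (j + i)) : occ P w = 0 := by
  rw [occ, Finset.card_eq_zero, Finset.filter_eq_empty_iff]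
  exact fun j _ => h j

/-- A factor of a periodic sequence inherits its period; this excludes Lyndon patterns longer than
`w`. -/
theorem period_of_match {P w : Word} {j : ℕ}
    (h : ∀ i : Fin P.length, P.get i = periodic w (j + i)) {i : ℕ}
    (hi : i + w.length < P.length) : P[i]? = P[i + w.length]? := by
  have h₁ := h ⟨i, by omega⟩
  have h₂ := h ⟨i + w.length, hi⟩
  have e : j + (i + w.length) = w.length + (j + i) := by omega
  rw [show periodic w (j + (i + w.length)) = periodic w (j + i) by
    rw [e, periodic_length_add]] at h₂
  rw [List.getElem?_eq_getElem (by omega), List.getElem?_eq_getElem hi]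
  exact congrArg some (h₁.trans h₂.symm)

theorem occ_eq_zero_of_length_lt {P w : Word} (hP : P ∈ lyndonWords) (hw : w ≠ [])
    (hlt : w.length < P.length) : occ P w = 0 :=
  occ_eq_zero_of_forall fun _ h =>
    not_period_of_mem_lyndonWords hP (List.length_pos_iff.mpr hw) hlt fun _ hi =>
      period_of_match h hi

theorem occ_transpose_eq_zero_of_length_lt {P w : Word} (hP : P ∈ lyndonWords) (hw : w ≠ [])
    (hlt : w.length < P.length) : occ (transpose P) w = 0 := by
  refine occ_eq_zero_of_forall fun _ h =>
    not_period_of_mem_lyndonWords hP (List.length_pos_iff.mpr hw) hlt fun i hi => ?_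
  have h' := period_of_match h (i := P.length - 1 - (i + w.length))
    (by rw [length_transpose]; omega)
  rw [getElem?_transpose (by omega), getElem?_transpose (by omega)] at h'
  have e₁ : P.length - 1 - (P.length - 1 - (i + w.length)) = i + w.length := by omega
  have e₂ : P.length - 1 - (P.length - 1 - (i + w.length) + w.length) = i := by omega
  rw [e₁, e₂] at h'
  exact (Option.map_injective Bool.not_injective h').symm

theorem rotate_eq_iff_match {P Q : Word} (hlen : P.length = Q.length) (j : ℕ) :
    Q.rotate j = P ↔ ∀ i : Fin P.length, P.get i = periodic Q (j + i) := by
  have hper : ∀ (i : ℕ) (hi : i < (Q.rotate j).length),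
      (Q.rotate j)[i] = periodic Q (j + i) := by
    intro i hi
    rw [List.length_rotate] at hi
    have hmod : (i + j) % Q.length < Q.length := Nat.mod_lt _ (by omega)
    rw [List.getElem_rotate, periodic, add_comm j i, List.getD_eq_getElem _ _ hmod]
  constructor
  · rintro rfl i
    exact hper i i.2
  · intro h
    apply List.ext_getElem (by rw [List.length_rotate, hlen])
    intro i h₁ h₂
    rw [hper i h₁]
    exact (h ⟨i, h₂⟩).symm

theorem occ_eq_zero_of_not_isRotated {P Q : Word} (hlen : P.length = Q.length)
    (h : ¬ P ~r Q) : occ P Q = 0 :=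
  occ_eq_zero_of_forall fun j hj =>
    h (List.IsRotated.symm ⟨j, (rotate_eq_iff_match hlen j).mpr hj⟩)

theorem occ_self {P : Word} (hP : P ∈ lyndonWords) (hne : P ≠ []) : occ P P = 1 := by
  have : (Finset.range P.length).filter
      (fun j => ∀ i : Fin P.length, P.get i = periodic P (j + i)) = {0} := by
    ext j
    simp only [Finset.mem_filter, Finset.mem_range, Finset.mem_singleton,
      ← rotate_eq_iff_match rfl]
    constructor
    · rintro ⟨hj, h⟩
      by_contra hj0
      have := hP j (Nat.pos_of_ne_zero hj0) hj
      rw [h] at this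
      exact lt_irrefl _ this
    · rintro rfl
      exact ⟨List.length_pos_iff.mpr hne, List.rotate_zero P⟩
  rw [occ, this, Finset.card_singleton]

theorem le_of_isRotated_of_mem_lyndonWords {P Q : Word} (hP : P ∈ lyndonWords) (h : P ~r Q) :
    Q ≤ P := by
  obtain ⟨k, hk, rfl⟩ := List.isRotated_iff_mod.mp h
  rcases Nat.eq_zero_or_pos k with rfl | hk0
  · rw [List.rotate_zero]
  rcases hk.eq_or_lt with rfl | hlt
  · rw [List.rotate_length]
  · exact (hP k hk0 hlt).le

theorem eq_of_isRotated_of_mem_lyndonWords {P Q : Word} (hP : P ∈ lyndonWords)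
    (hQ : Q ∈ lyndonWords) (h : P ~r Q) : P = Q :=
  le_antisymm (le_of_isRotated_of_mem_lyndonWords hQ h.symm)
    (le_of_isRotated_of_mem_lyndonWords hP h)

theorem le_foldr_max {l : List Word} {x : Word} (hx : x ∈ l) : x ≤ l.foldr max [] := by
  induction l with
  | nil => simp at hx
  | cons a l ih =>
    rw [List.foldr_cons]
    rcases List.mem_cons.mp hx with rfl | hx
    · exact le_max_left _ _
    · exact (ih hx).trans (le_max_right _ _)

theorem foldr_max_mem {l : List Word} (hl : l ≠ []) : l.foldr max [] ∈ l := by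
  induction l with
  | nil => exact absurd rfl hl
  | cons a l ih =>
    rw [List.foldr_cons]
    rcases max_choice a (l.foldr max []) with h | h
    · rw [h]
      exact List.mem_cons_self
    · by_cases hl' : l = []
      · subst hl'
        rw [List.foldr_nil, max_eq_left (not_lt.mp (List.not_lt_nil a))]
        exact List.mem_cons_self
      · rw [h]
        exact List.mem_cons_of_mem _ (ih hl')

/-- The greatest cyclic permutation of a word. -/
def maxRotation (w : Word) : Word := w.cyclicPermutations.foldr max []

theorem maxRotation_isRotated (w : Word) : maxRotation w ~r w :=
  List.mem_cyclicPermutations_iff.mp (foldr_max_mem (List.cyclicPermutations_ne_nil w))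

theorem le_maxRotation {v w : Word} (h : v ~r w) : v ≤ maxRotation w :=
  le_foldr_max (List.mem_cyclicPermutations_iff.mpr h)

theorem eq_maxRotation {P w : Word} (hP : P ∈ lyndonWords) (h : P ~r w) : P = maxRotation w :=
  le_antisymm (le_maxRotation h)
    (le_of_isRotated_of_mem_lyndonWords hP (h.trans (maxRotation_isRotated w).symm))

/-- A homogeneous quasi-morphism that vanishes on the short Lyndon words vanishes on all short
words. -/
theorem map_toPSL_eq_zero_of_lyndonWords {f : PSLZ → ℝ} (hf : f ∈ PX PSLZ) {N : ℕ}
    (h : ∀ Q ∈ lyndonWords, Q.length ≤ N → f (toPSL Q) = 0) {w : Word}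
    (hw : w.length ≤ N) : f (toPSL w) = 0 := by
  induction hn : w.length using Nat.strong_induction_on generalizing w with
  | _ n ih =>
  subst hn
  have hrot := maxRotation_isRotated w
  have hlen : (maxRotation w).length = w.length := hrot.perm.length_eq
  rw [← map_eq_of_isConj hf (isConj_toPSL_of_isRotated hrot)]
  set M := maxRotation w with hM
  by_cases hlyn : M ∈ lyndonWords
  · exact h M hlyn (by omega)
  · simp only [lyndonWords, Set.mem_ofPred_eq, not_forall] at hlyn
    obtain ⟨k, hk0, hk, hnlt⟩ := hlyn
    have hle : M.rotate k ≤ M := le_maxRotation ((List.IsRotated.forall M k).trans hrot)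
    -- A maximal rotation that is not Lyndon is fixed by a proper rotation, so its two pieces
    -- commute and induction applies to each.
    have heq : M.rotate k = M := hle.eq_of_not_lt hnlt
    rw [List.rotate_eq_drop_append_take hk.le] at heq
    have hsplit := List.take_append_drop k M
    have hcomm : Commute (toPSL (M.take k)) (toPSL (M.drop k)) := by
      rw [Commute, SemiconjBy, ← toPSL_append, ← toPSL_append, hsplit, heq]
    have h₁ : f (toPSL (M.take k)) = 0 :=
      ih _ (by rw [List.length_take]; omega) (by rw [List.length_take]; omega) rfl
    have h₂ : f (toPSL (M.drop k)) = 0 :=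
      ih _ (by rw [List.length_drop]; omega) (by rw [List.length_drop]; omega) rfl
    rw [← hsplit, toPSL_append, map_mul_of_commute hf hcomm, h₁, h₂, add_zero]

end ModularWord

/-! ### Half-systems of Lyndon words, triangularity and independence. -/

namespace ModularWord

/-- A set of Lyndon words that contains exactly one of each pair of asymmetric Lyndon words
exchanged by transposition. -/
structure IsHalfSystem (X : Set Word) : Prop where
  mem_lyndonWords : ∀ P ∈ X, P ∈ lyndonWords
  ne_nil : ∀ P ∈ X, P ≠ []
  not_isRotated_transpose : ∀ P ∈ X, ∀ Q ∈ X, ¬ transpose P ~r Q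
  cover : ∀ Q ∈ lyndonWords, Q ∈ X ∨ (∃ P ∈ X, Q ~r transpose P) ∨ transpose Q ~r Q

theorem isHalfSystem_of_partition {X Y : Set Word} (hdisj : Disjoint X Y)
    (hunion : X ∪ Y = lyndonWords \ symmetricLyndonWords) (hbij : Set.BijOn lyndonTranspose X Y) :
    IsHalfSystem X where
  mem_lyndonWords P hP := (hunion.subset (Or.inl hP)).1
  ne_nil := by
    rintro P hP rfl
    -- The empty word is vacuously Lyndon, but it is its own transpose and hence symmetric.
    have h := hunion.subset (Or.inl hP)
    exact h.2 ⟨h.1, List.IsRotated.refl _⟩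
  not_isRotated_transpose P hP Q hQ h := by
    have hQ' : Q = lyndonTranspose P := eq_maxRotation (hunion.subset (Or.inl hQ)).1 h.symm
    exact Set.disjoint_left.mp hdisj hQ (hQ' ▸ hbij.mapsTo hP)
  cover Q hQ := by
    by_cases hs : transpose Q ~r Q
    · exact Or.inr (Or.inr hs)
    · rcases hunion.superset ⟨hQ, fun h => hs h.2⟩ with h | h
      · exact Or.inl h
      · obtain ⟨P, hP, rfl⟩ := hbij.surjOn h
        exact Or.inr (Or.inl ⟨P, hP, maxRotation_isRotated _⟩)

namespace IsHalfSystem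

variable {X : Set Word}

theorem masReal_mem_PX (hX : IsHalfSystem X) {P : Word} (hP : P ∈ X) : masReal P ∈ PX PSLZ :=
  ModularWord.masReal_mem_PX (hX.ne_nil P hP)

theorem masReal_eq_zero_of_length_lt (hX : IsHalfSystem X) {P : Word} (hP : P ∈ X) {w : Word}
    (hw : w ≠ []) (hlt : w.length < P.length) {A : PSLZ} (hA : IsConj (toPSL w) A) :
    masReal P A = 0 := by
  have hL := hX.mem_lyndonWords P hP
  rw [masReal_eq_of_isConj (hX.ne_nil P hP) hA, occ_eq_zero_of_length_lt hL hw hlt,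
    occ_transpose_eq_zero_of_length_lt hL hw hlt, sub_self]

theorem masReal_self (hX : IsHalfSystem X) {P : Word} (hP : P ∈ X) :
    masReal P (toPSL P) = 1 := by
  rw [masReal_eq_of_isConj (hX.ne_nil P hP) (IsConj.refl _),
    occ_self (hX.mem_lyndonWords P hP) (hX.ne_nil P hP),
    occ_eq_zero_of_not_isRotated (length_transpose P) (hX.not_isRotated_transpose P hP P hP)]
  simp

theorem masReal_eq_zero_of_ne (hX : IsHalfSystem X) {P Q : Word} (hP : P ∈ X) (hQ : Q ∈ X)
    (hle : Q.length ≤ P.length) (hne : P ≠ Q) : masReal P (toPSL Q) = 0 := by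
  rcases hle.lt_or_eq with hlt | heq
  · exact hX.masReal_eq_zero_of_length_lt hP (hX.ne_nil Q hQ) hlt (IsConj.refl _)
  · have h : ¬ P ~r Q := fun h => hne
      (eq_of_isRotated_of_mem_lyndonWords (hX.mem_lyndonWords P hP) (hX.mem_lyndonWords Q hQ) h)
    rw [masReal_eq_of_isConj (hX.ne_nil P hP) (IsConj.refl _),
      occ_eq_zero_of_not_isRotated heq.symm h,
      occ_eq_zero_of_not_isRotated ((length_transpose P).trans heq.symm)
        (hX.not_isRotated_transpose P hP Q hQ), sub_self]

/-- On a given element, the asymmetries of all sufficiently long patterns vanish. -/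
theorem exists_masReal_eq_zero (hX : IsHalfSystem X) (A : PSLZ) :
    ∃ N : ℕ, ∀ P ∈ X, N ≤ P.length → masReal P A = 0 := by
  rcases torsion_or_isConj A with ⟨n, hn, hA⟩ | ⟨w, hw, hA⟩
  · exact ⟨0, fun P hP _ => map_eq_zero_of_pow_eq_one (hX.masReal_mem_PX hP) hn hA⟩
  · exact ⟨w.length + 1, fun P hP hlen => hX.masReal_eq_zero_of_length_lt hP hw hlen hA⟩

theorem finite_masReal_ne_zero (hX : IsHalfSystem X) (A : PSLZ) :
    {P ∈ X | masReal P A ≠ 0}.Finite := by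
  obtain ⟨N, hN⟩ := hX.exists_masReal_eq_zero A
  refine (List.finite_length_lt Bool N).subset fun P hP => ?_
  by_contra hlen
  exact hP.2 (hN P hP.1 (not_lt.mp hlen))

theorem finite_support_mul_masReal (hX : IsHalfSystem X) (m : X → ℝ) (A : PSLZ) :
    (Function.support fun P : X => m P * masReal P A).Finite := by
  refine Set.Finite.of_finite_image ((hX.finite_masReal_ne_zero A).subset ?_)
    Subtype.val_injective.injOn
  rintro _ ⟨P, hP, rfl⟩
  exact ⟨P.2, right_ne_zero_of_mul hP⟩

/-- Evaluating at `Q` isolates `d Q`: shorter patterns have zero coefficient by induction, and the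
other patterns vanish at `Q`. -/
theorem eq_zero_of_finsum_eq_zero (hX : IsHalfSystem X) {d : X → ℝ}
    (h : ∀ A : PSLZ, ∑ᶠ P : X, d P * masReal P A = 0) : d = 0 := by
  funext Q
  induction hn : (Q : Word).length using Nat.strong_induction_on generalizing Q with
  | _ n ih =>
  have hQ := h (toPSL Q)
  rw [finsum_eq_single _ Q, hX.masReal_self Q.2, mul_one] at hQ
  · exact hQ
  · intro P hPQ
    rcases lt_or_ge (P : Word).length (Q : Word).length with hlt | hge
    · rw [ih _ (hn ▸ hlt) P rfl, Pi.zero_apply, zero_mul]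
    · rw [hX.masReal_eq_zero_of_ne P.2 Q.2 hge (Subtype.coe_ne_coe.mpr hPQ), mul_zero]

theorem linearIndependent_masReal (hX : IsHalfSystem X) :
    LinearIndependent ℝ (fun P : X => masReal (P : Word)) := by
  rw [linearIndependent_iff]
  intro l hl
  apply DFunLike.coe_injective
  refine hX.eq_zero_of_finsum_eq_zero fun A => ?_
  rw [finsum_eq_sum_of_support_subset (s := l.support)]
  · have := congrFun hl A
    rw [Finsupp.linearCombination_apply, Finsupp.sum, Finset.sum_apply] at this
    simpa using this
  · intro P hP
    exact Finsupp.mem_support_iff.mpr (left_ne_zero_of_mul hP)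

end IsHalfSystem

/-! ### Expansion of a homogeneous quasi-morphism, one length at a time. -/

theorem finite_layer (X : Set Word) (n : ℕ) : {P ∈ X | P.length = n}.Finite :=
  (List.finite_length_eq Bool n).subset fun _ hP => hP.2

theorem finite_lower (X : Set Word) (n : ℕ) : {P ∈ X | P.length < n}.Finite :=
  (List.finite_length_lt Bool n).subset fun _ hP => hP.2

/-- What remains of `f` after subtracting the asymmetries of the patterns of length less
than `n`, with coefficients chosen so that the remainder vanishes on these patterns. -/
noncomputable def residual (X : Set Word) (f : PSLZ → ℝ) : ℕ → PSLZ → ℝ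
  | 0 => f
  | n + 1 => residual X f n -
      ∑ P ∈ (finite_layer X n).toFinset, residual X f n (toPSL P) • masReal P

/-- The coefficient of the pattern `P` in the expansion of `f`. -/
noncomputable def coefficient (X : Set Word) (f : PSLZ → ℝ) (P : Word) : ℝ :=
  residual X f P.length (toPSL P)

theorem residual_succ (X : Set Word) (f : PSLZ → ℝ) (n : ℕ) :
    residual X f (n + 1) = residual X f n -
      ∑ P ∈ (finite_layer X n).toFinset, coefficient X f P • masReal P := by
  rw [residual]
  congr 1
  refine Finset.sum_congr rfl fun P hP => ?_
  rw [Set.Finite.mem_toFinset] at hP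
  rw [coefficient, hP.2]

theorem residual_eq (X : Set Word) (f : PSLZ → ℝ) (n : ℕ) :
    residual X f n =
      f - ∑ P ∈ (finite_lower X n).toFinset, coefficient X f P • masReal P := by
  classical
  induction n with
  | zero => simp [residual]
  | succ n ih =>
    have hsplit : (finite_lower X (n + 1)).toFinset
        = (finite_lower X n).toFinset ∪ (finite_layer X n).toFinset := by
      ext P
      simp only [Set.Finite.mem_toFinset, Finset.mem_union, Set.mem_ofPred_eq,
        Nat.lt_succ_iff_lt_or_eq, and_or_left]
    have hdisj : Disjoint (finite_lower X n).toFinset (finite_layer X n).toFinset := by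
      rw [Finset.disjoint_left]
      intro P h₁ h₂
      rw [Set.Finite.mem_toFinset] at h₁ h₂
      exact h₁.2.ne h₂.2
    rw [residual_succ, ih, hsplit, Finset.sum_union hdisj, sub_sub]

theorem finsum_mul_masReal (X : Set Word) (c : Word → ℝ) {A : PSLZ} {n : ℕ}
    (hn : ∀ P ∈ X, n ≤ P.length → masReal P A = 0) :
    ∑ᶠ P : X, c P * masReal P A
      = ∑ P ∈ (finite_lower X n).toFinset, c P * masReal P A := by
  rw [finsum_subtype_eq_finsum_cond (f := fun P => c P * masReal P A) (fun P => P ∈ X)]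
  refine finsum_mem_eq_sum_of_inter_support_eq _ ?_
  ext P
  simp only [Set.mem_inter_iff, Function.mem_support, Set.Finite.coe_toFinset, Set.mem_ofPred_eq]
  constructor
  · rintro ⟨hP, h⟩
    refine ⟨⟨hP, ?_⟩, h⟩
    by_contra hlen
    exact h (by rw [hn P hP (not_lt.mp hlen), mul_zero])
  · rintro ⟨⟨hP, -⟩, h⟩
    exact ⟨hP, h⟩

namespace IsHalfSystem

variable {X : Set Word} {f : PSLZ → ℝ}

theorem residual_mem_PX (hX : IsHalfSystem X) (hf : f ∈ PX PSLZ) (n : ℕ) :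
    residual X f n ∈ PX PSLZ := by
  rw [residual_eq]
  refine sub_mem hf (sum_mem fun P hP => Submodule.smul_mem _ _ (hX.masReal_mem_PX ?_))
  rw [Set.Finite.mem_toFinset] at hP
  exact hP.1

/-- Subtracting a layer cancels the values at its own patterns and, by triangularity, leaves those
at shorter patterns unchanged. -/
theorem residual_apply_of_mem (hX : IsHalfSystem X) {Q : Word} (hQ : Q ∈ X) {n : ℕ}
    (hn : Q.length < n) : residual X f n (toPSL Q) = 0 := by
  induction n with
  | zero => exact absurd hn (Nat.not_lt_zero _)
  | succ n ih =>
    rw [residual_succ, Pi.sub_apply, Finset.sum_apply]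
    rcases (Nat.lt_succ_iff.mp hn).lt_or_eq with hlt | heq
    · rw [ih hlt, Finset.sum_eq_zero, sub_zero]
      intro P hP
      rw [Set.Finite.mem_toFinset] at hP
      have hPQ : Q.length < P.length := hP.2 ▸ hlt
      rw [Pi.smul_apply, hX.masReal_eq_zero_of_ne hP.1 hQ hPQ.le (by rintro rfl; omega),
        smul_zero]
    · rw [Finset.sum_eq_single Q, Pi.smul_apply, hX.masReal_self hQ, coefficient, heq]
      · simp
      · intro P hP hne
        rw [Set.Finite.mem_toFinset] at hP
        rw [Pi.smul_apply, hX.masReal_eq_zero_of_ne hP.1 hQ (heq.trans hP.2.symm).le hne,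
          smul_zero]
      · intro h
        exact absurd ((finite_layer X n).mem_toFinset.mpr ⟨hQ, heq⟩) h

/-- It suffices to treat Lyndon words: a member of `X` is already settled, a transposed one follows
by oddness, and a symmetric one has a value equal to its own negative. -/
theorem residual_toPSL (hX : IsHalfSystem X) (hf : f ∈ PX PSLZ) {w : Word} {n : ℕ}
    (hn : w.length < n) : residual X f n (toPSL w) = 0 := by
  have hr := hX.residual_mem_PX hf n
  refine map_toPSL_eq_zero_of_lyndonWords hr (N := w.length) (fun Q hQ hlen => ?_) le_rfl
  rcases hX.cover Q hQ with h | ⟨P, hP, h⟩ | h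
  · exact hX.residual_apply_of_mem h (by omega)
  · have hPlen : Q.length = P.length := h.perm.length_eq.trans (length_transpose P)
    rw [map_eq_of_isConj hr (isConj_toPSL_of_isRotated h), map_toPSL_transpose hr,
      hX.residual_apply_of_mem hP (by omega), neg_zero]
  · have := map_eq_of_isConj hr (isConj_toPSL_of_isRotated h)
    rw [map_toPSL_transpose hr] at this
    linarith

theorem eq_finsum_coefficient (hX : IsHalfSystem X) (hf : f ∈ PX PSLZ) (A : PSLZ) :
    f A = ∑ᶠ P : X, coefficient X f P * masReal P A := by
  suffices h : ∃ n, residual X f n A = 0 ∧ ∀ P ∈ X, n ≤ P.length → masReal P A = 0 by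
    obtain ⟨n, h₀, hn⟩ := h
    rw [residual_eq, Pi.sub_apply, Finset.sum_apply, sub_eq_zero] at h₀
    rw [finsum_mul_masReal X _ hn, h₀]
    rfl
  rcases torsion_or_isConj A with ⟨k, hk, hA⟩ | ⟨w, hw, hA⟩
  · exact ⟨0, map_eq_zero_of_pow_eq_one (hX.residual_mem_PX hf 0) hk hA, fun P hP _ =>
      map_eq_zero_of_pow_eq_one (hX.masReal_mem_PX hP) hk hA⟩
  · refine ⟨w.length + 1, ?_, fun P hP hlen => hX.masReal_eq_zero_of_length_lt hP hw hlen hA⟩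
    rw [← map_eq_of_isConj (hX.residual_mem_PX hf _) hA]
    exact hX.residual_toPSL hf (Nat.lt_succ_self _)

theorem existsUnique_eq_finsum (hX : IsHalfSystem X) (hf : f ∈ PX PSLZ) :
    ∃! m : X → ℝ, ∀ A : PSLZ, f A = ∑ᶠ P : X, m P * masReal P A := by
  refine ⟨fun P => coefficient X f P, hX.eq_finsum_coefficient hf, fun m hm => ?_⟩
  rw [← sub_eq_zero]
  refine hX.eq_zero_of_finsum_eq_zero fun A => ?_
  simp only [Pi.sub_apply, sub_mul]
  rw [finsum_sub_distrib (hX.finite_support_mul_masReal _ A) (hX.finite_support_mul_masReal _ A),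
    ← hm A, ← hX.eq_finsum_coefficient hf A, sub_self]

end IsHalfSystem

end ModularWord

theorem mainTheorem9 (Pplus Pminus : Set ModularWord.Word)
    (hdisj : Disjoint Pplus Pminus)
    (hunion : Pplus ∪ Pminus = ModularWord.lyndonWords \ ModularWord.symmetricLyndonWords)
    (hbij : Set.BijOn ModularWord.lyndonTranspose Pplus Pminus) :
    (∀ P ∈ Pplus, ModularWord.masReal P ∈ ModularWord.PX ModularWord.PSLZ) ∧
    LinearIndependent ℝ (fun P : Pplus => ModularWord.masReal (P : ModularWord.Word)) ∧
    (∀ A : ModularWord.PSLZ, {P ∈ Pplus | ModularWord.masReal P A ≠ 0}.Finite) ∧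
    ∀ f ∈ ModularWord.PX ModularWord.PSLZ, ∃! m : Pplus → ℝ,
      ∀ A : ModularWord.PSLZ, f A = ∑ᶠ P : Pplus, m P * ModularWord.masReal P A := by
  have hX := ModularWord.isHalfSystem_of_partition hdisj hunion hbij
  exact ⟨fun P hP => hX.masReal_mem_PX hP, hX.linearIndependent_masReal,
    hX.finite_masReal_ne_zero, fun f hf => hX.existsUnique_eq_finsum hf⟩
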